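/- **Theorem 3 (accuracy of the optimal linear two-layer GCN on the binary cSBM).** Fix reals $d\ge 0$, $\lambda$ with $|\lambda|\le\sqrt d$, $\mu$, $\sigma>0$, $K\ne 0$ and a unit vector $m\in\mathbb R^{m_{\mathrm{feat}}}$. For even $n\ge 2$, let the binary contextual stochastic block model (cSBM) on $n$ nodes be the following random tuple $x=(G,i,v,X)$: the labelling $v:\{1,\dots,n\}\to\{-1,1\}$ is uniform among those with two classes of equal size and the base node $i$ is uniform and independent of $v$; given $(i,v)$, distinct nodes are joined by an edge of $G$ independently, with probability $p_{\mathrm{in}}=\frac{d+\lambda\sqrt d}{n}$ if they have the same class and $p_{\mathrm{out}}=\frac{d-\lambda\sqrt d}{n}$ otherwise ($n$ is taken so large that these are at most $1$); and, independently of $G$, the features are $X(k)=v_k\,\mu\, m+z_k$ with independent Gaussian vectors $z_k$ of mean $0$ and covariance $\sigma^2 I$. Let $\mathcal N(j)$ be the set consisting of $j$ and its neighbors in $G$ (self-loops are added), let $\mathcal N(x)=\mathcal N(i)$, and consider the linear model \[ y(x)=K\sum_{j\in\mathcal N(x)}\ \sum_{k\in\mathcal N(j)}X(k)\cdot m . \]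 Its accuracy is the probability that $\operatorname{sgn}(y(x))=v_i$. In the large-node limit $n\to\infty$ (with $d,\lambda,\mu,\sigma,K,m$ fixed), the accuracy converges to the convergent sum \[ \sum_{n_{\mathrm{in}},\,n_{\mathrm{out}},\,n_{2-\mathrm{in}},\,n_{2-\mathrm{out}}=0}^{\infty}P(n_{\mathrm{in}},n_{\mathrm{out}},n_{2-\mathrm{in}},n_{2-\mathrm{out}})\;\Phi\!\left(\psi\!\left(\operatorname{sgn}(K)\tfrac{\mu}{\sigma},n_{\mathrm{in}},n_{\mathrm{out}},n_{2-\mathrm{in}},n_{2-\mathrm{out}}\right)\right), \] where $\Phi$ is the cdf of the standard normal distribution, $d_{\mathrm{in}}=\frac{d+\lambda\sqrt d}{2}$, $d_{\mathrm{out}}=\frac{d-\lambda\sqrt d}{2}$, $p(k,r)=\frac{r^k e^{-r}}{k!}$ (with $0^0=1$), \[ P(n_{\mathrm{in}},n_{\mathrm{out}},n_{2-\mathrm{in}},n_{2-\mathrm{out}})=p(n_{\mathrm{in}},d_{\mathrm{in}})\,p(n_{\mathrm{out}},d_{\mathrm{out}})\,p(n_{2-\mathrm{in}},d_{\mathrm{in}}n_{\mathrm{in}}+d_{\mathrm{out}}n_{\mathrm{out}})\,p(n_{2-\mathrm{out}},d_{\mathrm{out}}n_{\mathrm{in}}+d_{\mathrm{in}}n_{\mathrm{out}}),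 \] \[ \psi(c,n_{\mathrm{in}},n_{\mathrm{out}},n_{2-\mathrm{in}},n_{2-\mathrm{out}})=c\,\frac{1+3n_{\mathrm{in}}-n_{\mathrm{out}}+n_{2-\mathrm{in}}-n_{2-\mathrm{out}}}{\sqrt{(n_{\mathrm{in}}+n_{\mathrm{out}}+1)^2+4(n_{\mathrm{in}}+n_{\mathrm{out}})+(n_{2-\mathrm{in}}+n_{2-\mathrm{out}})}} . \] -/

import Mathlib

open MeasureTheory ProbabilityTheory Filter Topology

noncomputable section

namespace CSBM

/-- The feature space `ℝ^f` with its Euclidean structure. -/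
abbrev Feat (f : ℕ) : Type := EuclideanSpace ℝ (Fin f)

/-- Tuples `(G, i, v, X)`: a graph on `n` nodes, a base node, the classes `±1` of the nodes, and
the feature vectors of the nodes. -/
abbrev Sample (n f : ℕ) : Type :=
  SimpleGraph (Fin n) × Fin n × (Fin n → ℤˣ) × (Fin n → Feat f)

namespace Sample

variable {n f : ℕ}

/-- The graph of a sample (without self-loops). -/
def graph (x : Sample n f) : SimpleGraph (Fin n) := x.1

/-- The base node of a sample. -/
def node (x : Sample n f) : Fin n := x.2.1

/-- The class labels of a sample. -/
def label (x : Sample n f) : Fin n → ℤˣ := x.2.2.1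

/-- The node features of a sample. -/
def feature (x : Sample n f) : Fin n → Feat f := x.2.2.2

end Sample

/-- The two classes have the same size. -/
def Balanced {n : ℕ} (v : Fin n → ℤˣ) : Prop :=
  Nat.card {i // v i = 1} = Nat.card {i // v i = -1}

open Classical in
/-- The probability that the pair of nodes `e` is joined by an edge: `(d + lam √d) / n` within a
class and `(d - lam √d) / n` between the classes. The truncation to `[0, 1]` is inactive for all
large `n` when `|lam| ≤ √d`. -/
def edgeProb {n : ℕ} (d lam : ℝ) (v : Fin n → ℤˣ) (e : Sym2 (Fin n)) : unitInterval :=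
  Set.projIcc 0 1 zero_le_one
    (if (e.map v).IsDiag then (d + lam * √d) / n else (d - lam * √d) / n)

/-- The law of the graph of the stochastic block model with class labels `v`: an independent
Bernoulli draw for each unordered pair of nodes (`SimpleGraph.fromEdgeSet` ignores the draws at
the diagonal pairs). -/
def graphLaw {n : ℕ} (d lam : ℝ) (v : Fin n → ℤˣ) : Measure (SimpleGraph (Fin n)) :=
  (Measure.pi fun e : Sym2 (Fin n) => bernoulliMeasure True False (edgeProb d lam v e)).map
    fun ω => SimpleGraph.fromEdgeSet {e | ω e}

/-- The law of the noise: independent centred Gaussian vectors `z i` with covariance `s ^ 2 • I`. -/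
def noiseLaw (n f : ℕ) (s : ℝ) : Measure (Fin n → Feat f) :=
  Measure.pi fun _ => (stdGaussian (Feat f)).map fun z => s • z

/-- The binary contextual stochastic block model: the base node `i` is uniform, the labelling `v`
is uniform among the balanced ones; given these, the graph and the noise `z` are independent,
and the features are `X k = v k • μ • m + z k`. -/
def csbm (n : ℕ) {f : ℕ} (d lam μ s : ℝ) (m : Feat f) : Measure (Sample n f) :=
  (uniformOn {iv : Fin n × (Fin n → ℤˣ) | Balanced iv.2}).bind fun iv =>
    ((graphLaw d lam iv.2).prod (noiseLaw n f s)).map fun Gz =>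
      (Gz.1, iv.1, iv.2, fun k => (((iv.2 k : ℤ) : ℝ) * μ) • m + Gz.2 k)

open Classical in
/-- The neighbourhood of `j` after a self-loop has been added at each node. -/
def nbhd {n : ℕ} (G : SimpleGraph (Fin n)) (j : Fin n) : Finset (Fin n) :=
  insert j (G.neighborFinset j)

/-- The linear two-layer model `K ∑_{j ∈ N(x)} ∑_{k ∈ N(j)} X(k) ⬝ m`. -/
def linearGCN {n f : ℕ} (K : ℝ) (m : Feat f) (x : Sample n f) : ℝ :=
  K * ∑ j ∈ nbhd x.graph x.node, ∑ k ∈ nbhd x.graph j, inner ℝ (x.feature k) m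

/-- The accuracy of a model `y`: the probability that the sign of its output is the class of the
base node. -/
def accuracy {n f : ℕ} (P : Measure (Sample n f)) (y : Sample n f → ℝ) : ℝ :=
  P.real {x | Real.sign (y x) = ((x.label x.node : ℤ) : ℝ)}

/-- `p(k, r) = r ^ k e ^ (-r) / k!`. -/
def poissonPmf (k : ℕ) (r : ℝ) : ℝ := r ^ k * Real.exp (-r) / (k.factorial : ℝ)

def dIn (d lam : ℝ) : ℝ := (d + lam * √d) / 2

def dOut (d lam : ℝ) : ℝ := (d - lam * √d) / 2

/-- The limiting probability of the numbers of nodes of the same and of the opposite class at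
distance one (`a`, `b`) and at distance two (`a₂`, `b₂`). -/
def countProb (d lam : ℝ) (a b a₂ b₂ : ℕ) : ℝ :=
  poissonPmf a (dIn d lam) * poissonPmf b (dOut d lam) *
    poissonPmf a₂ (dIn d lam * a + dOut d lam * b) *
    poissonPmf b₂ (dOut d lam * a + dIn d lam * b)

def psi (c : ℝ) (a b a₂ b₂ : ℕ) : ℝ :=
  c * ((1 + 3 * (a : ℝ) - b + a₂ - b₂) /
    √(((a : ℝ) + b + 1) ^ 2 + 4 * ((a : ℝ) + b) + ((a₂ : ℝ) + b₂)))

/-- The cumulative distribution function of the standard normal distribution. -/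
def Phi (t : ℝ) : ℝ := cdf (gaussianReal 0 1) t

end CSBM

end

/-! On the event that the two-step neighbourhood of the base node is a tree with prescribed numbers
of same-class and opposite-class nodes in its two layers (the shape `q`), the model output is an
affine function of independent Gaussians. Its mean and variance depend only on `q` and the label `v
i`, and the label cancels from the probability of a correct sign, which is therefore exactly `Phi
(psi ...)` (`HasShape.noise_correct`).

For the graph only lower bounds are needed. Summing over layers and parent maps bounds the
probability of shape `q` below by `shapeBound` (`hasShape_prob_ge`), which converges to `countProb`
(`tendsto_shapeBound`). Since the limits sum to 1 (`hasSum_countProb`), no mass is left for cycles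
or other shapes. Bounding both the correct event and its complement from below (`csbm_real_ge`) then
squeezes the accuracy to the series (`tendsto_of_sum_le`). -/

noncomputable section

namespace CSBM

/-! ### Two-step neighbourhoods that are trees, and the weighted sums over them. -/

section Graph

variable {n : ℕ}

/-- The two-step exploration of `G` from `i`: the neighbours of `i` are `R`, and the neighbours of
a node `j ∈ R` are `i` and the nodes of `S` whose parent `φ` is `j`. -/
def Explored (G : SimpleGraph (Fin n)) (i : Fin n) (R S : Finset (Fin n))
    (φ : Fin n → Fin n) : Prop :=
  (∀ k, G.Adj i k ↔ k ∈ R) ∧ ∀ j ∈ R, ∀ k, G.Adj j k ↔ k = i ∨ (k ∈ S ∧ φ k = j)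

/-- The two-step neighbourhood of `i` in `G` is a tree with first layer `R` and second layer `S`. -/
def LocalTree (G : SimpleGraph (Fin n)) (i : Fin n) (R S : Finset (Fin n)) : Prop :=
  i ∉ S ∧ Disjoint R S ∧ ∃ φ, (∀ k ∈ S, φ k ∈ R) ∧ Explored G i R S φ

lemma Explored.notMem {G : SimpleGraph (Fin n)} {i : Fin n} {R S : Finset (Fin n)}
    {φ : Fin n → Fin n} (h : Explored G i R S φ) : i ∉ R :=
  fun hi => G.loopless.irrefl i ((h.1 i).2 hi)

/-- `R` is the neighbour set of `i`, and `S` consists of the neighbours of `R` other than `i`, so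
the graph determines both. This makes the events for different layers disjoint. -/
lemma LocalTree.unique {G : SimpleGraph (Fin n)} {i : Fin n} {R S R' S' : Finset (Fin n)}
    (h : LocalTree G i R S) (h' : LocalTree G i R' S') : R = R' ∧ S = S' := by
  obtain ⟨hi, -, φ, hφ, h1, h2⟩ := h
  obtain ⟨hi', -, φ', hφ', h1', h2'⟩ := h'
  have hR : R = R' := by ext k; rw [← h1, h1']
  subst hR
  refine ⟨rfl, ?_⟩
  ext k
  constructor
  · intro hk
    rcases (h2' _ (hφ k hk) k).1 ((h2 _ (hφ k hk) k).2 (Or.inr ⟨hk, rfl⟩)) with rfl | h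
    · exact absurd hk hi
    · exact h.1
  · intro hk
    rcases (h2 _ (hφ' k hk) k).1 ((h2' _ (hφ' k hk) k).2 (Or.inr ⟨hk, rfl⟩)) with rfl | h
    · exact absurd hk hi'
    · exact h.1

/-- The multiplicity of `k` in the two-step sum of a local tree. -/
def treeWeight (i : Fin n) (R S : Finset (Fin n)) (k : Fin n) : ℝ :=
  if k = i then 1 + R.card else if k ∈ R then 2 else if k ∈ S then 1 else 0

lemma sum_layers {i : Fin n} {R S : Finset (Fin n)} (hR : i ∉ R) (hS : i ∉ S)
    (hRS : Disjoint R S) (x y z : Fin n → ℝ) :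
    ∑ k, (if k = i then x k else if k ∈ R then y k else if k ∈ S then z k else 0) =
      x i + ∑ k ∈ R, y k + ∑ k ∈ S, z k := by
  have : ∀ k, (if k = i then x k else if k ∈ R then y k else if k ∈ S then z k else 0) =
      (if k = i then x k else 0) + (if k ∈ R then y k else 0) + (if k ∈ S then z k else 0) := by
    intro k
    by_cases h1 : k = i
    · subst h1; simp [hR, hS]
    · by_cases h2 : k ∈ R
      · simp [h1, h2, Finset.disjoint_left.1 hRS h2]
      · simp [h1, h2]
  simp [this, Finset.sum_add_distrib]

/-- With self-loops, `i` is reached once from itself and once from each node of `R`; a node of `R`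
is reached from `i` and from itself; a node of `S` only from its parent. -/
lemma LocalTree.sum_nbhd {G : SimpleGraph (Fin n)} {i : Fin n} {R S : Finset (Fin n)}
    (h : LocalTree G i R S) (g : Fin n → ℝ) :
    ∑ j ∈ nbhd G i, ∑ k ∈ nbhd G j, g k = ∑ k, treeWeight i R S k * g k := by
  classical
  obtain ⟨hi, hd, φ, hφ, hE⟩ := h
  have hiR := hE.notMem
  obtain ⟨h1, h2⟩ := hE
  have hn : nbhd G i = insert i R := by ext k; simp [nbhd, h1]
  have hn' : ∀ j ∈ R, nbhd G j = insert j (insert i (S.filter (φ · = j))) := by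
    intro j hj; ext k; simp [nbhd, h2 j hj]
  have hs : ∀ j ∈ R, ∑ k ∈ nbhd G j, g k = g j + (g i + ∑ k ∈ S with φ k = j, g k) := by
    intro j hj
    have hji : j ≠ i := fun h => hiR (h ▸ hj)
    rw [hn' j hj, Finset.sum_insert, Finset.sum_insert]
    · simp [hi]
    · simp [hji, Finset.disjoint_left.1 hd hj]
  rw [hn, Finset.sum_insert hiR, hn, Finset.sum_insert hiR, Finset.sum_congr rfl hs,
    Finset.sum_add_distrib, Finset.sum_add_distrib, Finset.sum_fiberwise_of_maps_to hφ]
  simp only [treeWeight, ite_mul]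
  have := sum_layers hiR hi hd (fun k => (1 + (R.card : ℝ)) * g k) (fun k => 2 * g k)
    (fun k => 1 * g k)
  simp only [zero_mul]
  rw [this, ← Finset.mul_sum, ← Finset.mul_sum]
  simp
  ring

lemma LocalTree.sum_treeWeight_sq {G : SimpleGraph (Fin n)} {i : Fin n} {R S : Finset (Fin n)}
    (h : LocalTree G i R S) :
    ∑ k, treeWeight i R S k ^ 2 = ((R.card : ℝ) + 1) ^ 2 + 4 * R.card + S.card := by
  obtain ⟨hi, hd, φ, hφ, hE⟩ := h
  simp only [treeWeight, ite_pow, zero_pow two_ne_zero]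
  have := sum_layers hE.notMem hi hd (fun _ => (1 + (R.card : ℝ)) ^ 2) (fun _ => 2 ^ 2)
    (fun _ => 1 ^ 2)
  rw [this]
  simp
  ring

end Graph

/-! ### Lower bounds for cylinder events of independent draws. -/

section Cylinder

/-- Dropping repeated factors from `[0, 1]` can only increase a product, so `f` need not be
injective. -/
lemma prod_comp_le_prod_image {α β : Type*} [DecidableEq β] (s : Finset α) (f : α → β)
    (g : β → ℝ) (h0 : ∀ x, 0 ≤ g x) (h1 : ∀ x, g x ≤ 1) :
    ∏ x ∈ s, g (f x) ≤ ∏ y ∈ s.image f, g y := by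
  classical
  rw [Finset.prod_comp g f]
  refine Finset.prod_le_prod (fun y _ => pow_nonneg (h0 y) _) fun y hy => ?_
  refine pow_le_of_le_one (h0 y) (h1 y) ?_
  obtain ⟨x, hx, rfl⟩ := Finset.mem_image.1 hy
  exact Finset.card_ne_zero_of_mem (a := x) (by simp [hx])

/-- The law of independent Bernoulli draws. -/
abbrev drawLaw {ι : Type*} [Fintype ι] (p : ι → unitInterval) : Measure (ι → Prop) :=
  Measure.pi fun e => bernoulliMeasure True False (p e)

/-- The exact probability is a product over `T` of `p e` or `1 - p e`. The left side contains each
of these factors, and its superfluous ones (`1 - p e` at successes, overlaps, indices outside `T`)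
are at most 1. -/
lemma drawLaw_cylinder_ge {ι : Type*} [Fintype ι] [DecidableEq ι] (p : ι → unitInterval)
    (F₁ F₂ T : Finset ι) :
    (∏ e ∈ F₁, (p e : ℝ)) * (∏ e ∈ F₂, (p e : ℝ)) * ∏ e ∈ T, (1 - (p e : ℝ)) ≤
      (drawLaw p).real {ω | ∀ e ∈ T, ω e ↔ e ∈ F₁ ∨ e ∈ F₂} := by
  classical
  have hbox : {ω : ι → Prop | ∀ e ∈ T, ω e ↔ e ∈ F₁ ∨ e ∈ F₂} =
      Set.univ.pi fun e => {x : Prop | e ∈ T → (x ↔ e ∈ F₁ ∨ e ∈ F₂)} := by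
    ext ω; simp
  rw [hbox, measureReal_def, Measure.pi_pi, ENNReal.toReal_prod]
  simp only [← measureReal_def]
  rw [← Finset.prod_ite_mem_eq F₁, ← Finset.prod_ite_mem_eq F₂, ← Finset.prod_ite_mem_eq T,
    ← Finset.prod_mul_distrib, ← Finset.prod_mul_distrib]
  refine Finset.prod_le_prod (fun e _ => ?_) fun e _ => ?_
  · have := (p e).2.1
    have := (p e).2.2
    refine mul_nonneg (mul_nonneg ?_ ?_) ?_ <;> split_ifs <;> linarith
  · have h0 := (p e).2.1
    have h1 := (p e).2.2
    rw [bernoulliMeasure_real_apply _ (MeasurableSet.of_discrete)]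
    by_cases hT : e ∈ T <;> by_cases hF : e ∈ F₁ <;> by_cases hF' : e ∈ F₂ <;>
      simp [hT, hF, hF'] <;> nlinarith [mul_nonneg h0 h0]

end Cylinder

/-! ### Probability that the two-step neighbourhood is a tree of given shape. -/

section TreeProbability

variable {n : ℕ}

/-- The graph whose edges are the successful draws. -/
abbrev drawGraph (ω : Sym2 (Fin n) → Prop) : SimpleGraph (Fin n) :=
  SimpleGraph.fromEdgeSet {e | ω e}

lemma explored_prob_ge (p : Sym2 (Fin n) → unitInterval) {i : Fin n} {R S : Finset (Fin n)}
    (hR : i ∉ R) (hS : i ∉ S) (hRS : Disjoint R S) {φ : Fin n → Fin n} (hφ : ∀ k ∈ S, φ k ∈ R) :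
    (∏ k ∈ R, (p s(i, k) : ℝ)) * (∏ k ∈ S, (p s(φ k, k) : ℝ)) *
        ∏ u ∈ insert i R, ∏ w, (1 - (p s(u, w) : ℝ)) ≤
      (drawLaw p).real {ω | Explored (drawGraph ω) i R S φ} := by
  classical
  set F₁ := R.image fun k => s(i, k)
  set F₂ := S.image fun k => s(φ k, k)
  -- All pairs meeting `insert i R`. Diagonal pairs are included: the graph ignores them, so forcing
  -- them to fail only shrinks the event and keeps the product uniform in `w`.
  set T := (insert i R ×ˢ Finset.univ).image fun x : Fin n × Fin n => s(x.1, x.2)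
  have h0 : ∀ e, 0 ≤ (p e : ℝ) := fun e => (p e).2.1
  have h1 : ∀ e, (p e : ℝ) ≤ 1 := fun e => (p e).2.2
  have h0' : ∀ e, 0 ≤ 1 - (p e : ℝ) := fun e => sub_nonneg.2 (h1 e)
  have h1' : ∀ e, 1 - (p e : ℝ) ≤ 1 := fun e => by linarith [h0 e]
  calc _ ≤ (∏ e ∈ F₁, (p e : ℝ)) * (∏ e ∈ F₂, (p e : ℝ)) * ∏ e ∈ T, (1 - (p e : ℝ)) := by
        rw [← Finset.prod_product']
        have hF₁ := prod_comp_le_prod_image R (fun k => s(i, k)) _ h0 h1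
        have hF₂ := prod_comp_le_prod_image S (fun k => s(φ k, k)) _ h0 h1
        have hT := prod_comp_le_prod_image (insert i R ×ˢ Finset.univ)
          (fun x : Fin n × Fin n => s(x.1, x.2)) _ h0' h1'
        exact mul_le_mul (mul_le_mul hF₁ hF₂ (Finset.prod_nonneg fun _ _ => h0 _)
          (Finset.prod_nonneg fun _ _ => h0 _)) hT (Finset.prod_nonneg fun _ _ => h0' _)
          (mul_nonneg (Finset.prod_nonneg fun _ _ => h0 _) (Finset.prod_nonneg fun _ _ => h0 _))
    _ ≤ _ := drawLaw_cylinder_ge p F₁ F₂ T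
    _ ≤ _ := by
        refine measureReal_mono ?_
        intro ω hω
        have hω' : ∀ u ∈ insert i R, ∀ w, ω s(u, w) ↔ s(u, w) ∈ F₁ ∨ s(u, w) ∈ F₂ := by
          intro u hu w
          exact hω _ (Finset.mem_image.2 ⟨(u, w), by simpa using hu, rfl⟩)
        constructor
        · intro k
          simp only [SimpleGraph.fromEdgeSet_adj, Set.mem_ofPred_eq]
          rw [hω' i (Finset.mem_insert_self _ _) k]
          simp only [F₁, F₂, Finset.mem_image, Sym2.eq_iff]
          grind
        · intro j hj k
          simp only [SimpleGraph.fromEdgeSet_adj, Set.mem_ofPred_eq]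
          rw [hω' j (Finset.mem_insert_of_mem hj) k]
          simp only [F₁, F₂, Finset.mem_image, Sym2.eq_iff]
          have := Finset.disjoint_left.1 hRS hj
          grind

/-- The parent of each node of `S` may be any node of `R`, and different parent maps give disjoint
events; expanding the product of sums enumerates these maps. -/
lemma localTree_prob_ge (p : Sym2 (Fin n) → unitInterval) {i : Fin n} {R S : Finset (Fin n)}
    (hR : i ∉ R) (hS : i ∉ S) (hRS : Disjoint R S) :
    (∏ k ∈ R, (p s(i, k) : ℝ)) * (∏ k ∈ S, ∑ j ∈ R, (p s(j, k) : ℝ)) *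
        ∏ u ∈ insert i R, ∏ w, (1 - (p s(u, w) : ℝ)) ≤
      (drawLaw p).real {ω | LocalTree (drawGraph ω) i R S} := by
  classical
  -- Off `S` the parent is pinned to the dummy value `i`, so that each parent assignment is counted
  -- once.
  set t : Fin n → Finset (Fin n) := fun k => if k ∈ S then R else {i}
  have ht : ∀ φ ∈ Fintype.piFinset t, ∀ k ∈ S, φ k ∈ R := by
    intro φ hφ k hk
    simpa [t, hk] using Fintype.mem_piFinset.1 hφ k
  have hsum : ∏ k ∈ S, ∑ j ∈ R, (p s(j, k) : ℝ) =
      ∑ φ ∈ Fintype.piFinset t, ∏ k ∈ S, (p s(φ k, k) : ℝ) := by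
    have := Finset.prod_univ_sum t (fun k j => if k ∈ S then (p s(j, k) : ℝ) else 1)
    simp only [Finset.prod_ite_mem_eq] at this
    rw [← this, ← Finset.prod_ite_mem_eq S]
    refine Finset.prod_congr rfl fun k _ => ?_
    by_cases hk : k ∈ S <;> simp [t, hk]
  rw [hsum, Finset.mul_sum, Finset.sum_mul]
  calc _ ≤ ∑ φ ∈ Fintype.piFinset t, (drawLaw p).real {ω | Explored (drawGraph ω) i R S φ} :=
        Finset.sum_le_sum fun φ hφ => explored_prob_ge p hR hS hRS (ht φ hφ)
    _ = (drawLaw p).real (⋃ φ ∈ Fintype.piFinset t, {ω | Explored (drawGraph ω) i R S φ}) := by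
        refine (measureReal_biUnion_finset ?_ fun _ _ => MeasurableSet.of_discrete).symm
        -- For `k ∈ S`, the edge from `φ k` to `k` forces `φ' k = φ k` because `k ≠ i`.
        intro φ hφ φ' hφ' hne
        refine Set.disjoint_left.2 fun ω hω hω' => hne ?_
        ext1 k
        by_cases hk : k ∈ S
        · rcases (hω'.2 _ (ht φ hφ k hk) k).1 ((hω.2 _ (ht φ hφ k hk) k).2 (Or.inr ⟨hk, rfl⟩))
            with h | h
          · exact absurd (h ▸ hk) hS
          · exact h.2.symm
        · have h := Fintype.mem_piFinset.1 hφ k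
          have h' := Fintype.mem_piFinset.1 hφ' k
          simp only [t, hk, if_false, Finset.mem_singleton] at h h'
          rw [h, h']
    _ ≤ _ := by
        refine measureReal_mono ?_
        intro ω hω
        simp only [Set.mem_iUnion] at hω
        obtain ⟨φ, hφ, h⟩ := hω
        exact ⟨hS, hRS, φ, ht φ hφ, h⟩

/-- The other nodes in the class of `i`. -/
def sameClass (v : Fin n → ℤˣ) (i : Fin n) : Finset (Fin n) := {k | v k = v i ∧ k ≠ i}

/-- The nodes outside the class of `i`. -/
def otherClass (v : Fin n → ℤˣ) (i : Fin n) : Finset (Fin n) := {k | v k ≠ v i}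

/-- A choice of the two layers of a local tree at `i`, each split into the nodes in the class of
`i` and the other nodes. -/
abbrev Layers (n : ℕ) : Type :=
  Σ _ : Finset (Fin n) × Finset (Fin n), Finset (Fin n) × Finset (Fin n)

/-- The layers with prescribed numbers of nodes of each kind. -/
def layersOfShape (v : Fin n → ℤˣ) (i : Fin n) (q : ℕ × ℕ × ℕ × ℕ) : Finset (Layers n) :=
  ((sameClass v i).powersetCard q.1 ×ˢ (otherClass v i).powersetCard q.2.1).sigma fun x =>
    (sameClass v i \ x.1).powersetCard q.2.2.1 ×ˢ (otherClass v i \ x.2).powersetCard q.2.2.2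

/-- The two-step neighbourhood of `i` in `G` is a tree with the given layers. -/
def HasLayers (G : SimpleGraph (Fin n)) (i : Fin n) (l : Layers n) : Prop :=
  LocalTree G i (l.1.1 ∪ l.1.2) (l.2.1 ∪ l.2.2)

/-- The two-step neighbourhood of `i` in `G` is a tree whose layers have the given numbers of
nodes of each kind. -/
def HasShape (v : Fin n → ℤˣ) (i : Fin n) (q : ℕ × ℕ × ℕ × ℕ) (G : SimpleGraph (Fin n)) : Prop :=
  ∃ l ∈ layersOfShape v i q, HasLayers G i l

lemma mem_layersOfShape {v : Fin n → ℤˣ} {i : Fin n} {q : ℕ × ℕ × ℕ × ℕ} {l : Layers n} :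
    l ∈ layersOfShape v i q ↔
      ((l.1.1 ⊆ sameClass v i ∧ l.1.1.card = q.1) ∧
        (l.1.2 ⊆ otherClass v i ∧ l.1.2.card = q.2.1)) ∧
      ((l.2.1 ⊆ sameClass v i \ l.1.1 ∧ l.2.1.card = q.2.2.1) ∧
        (l.2.2 ⊆ otherClass v i \ l.1.2 ∧ l.2.2.card = q.2.2.2)) := by
  simp [layersOfShape, Finset.mem_powersetCard]

lemma disjoint_sameClass_otherClass (v : Fin n → ℤˣ) (i : Fin n) :
    Disjoint (sameClass v i) (otherClass v i) := by
  rw [Finset.disjoint_left]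
  intro k
  simp +contextual [sameClass, otherClass]

lemma eq_of_union_eq {v : Fin n → ℤˣ} {i : Fin n} {A B A' B' : Finset (Fin n)}
    (hA : A ⊆ sameClass v i) (hB : B ⊆ otherClass v i) (hA' : A' ⊆ sameClass v i)
    (hB' : B' ⊆ otherClass v i) (h : A ∪ B = A' ∪ B') : A = A' ∧ B = B' := by
  have hd := Finset.disjoint_left.1 (disjoint_sameClass_otherClass v i)
  have h' : ∀ k, k ∈ A ∨ k ∈ B ↔ k ∈ A' ∨ k ∈ B' := fun k => by
    rw [← Finset.mem_union, h, Finset.mem_union]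
  constructor <;> ext k <;> have := h' k <;> have := @hA k <;> have := @hB k <;>
    have := @hA' k <;> have := @hB' k <;> have := @hd k <;> tauto

lemma HasLayers.unique {v : Fin n → ℤˣ} {i : Fin n} {q q' : ℕ × ℕ × ℕ × ℕ} {l l' : Layers n}
    {G : SimpleGraph (Fin n)} (hl : l ∈ layersOfShape v i q) (hl' : l' ∈ layersOfShape v i q')
    (h : HasLayers G i l) (h' : HasLayers G i l') : l = l' := by
  rw [mem_layersOfShape] at hl hl'
  obtain ⟨h1, h2⟩ := LocalTree.unique h h'
  obtain ⟨hA, hB⟩ := eq_of_union_eq hl.1.1.1 hl.1.2.1 hl'.1.1.1 hl'.1.2.1 h1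
  obtain ⟨hA', hB'⟩ := eq_of_union_eq (hl.2.1.1.trans Finset.sdiff_subset)
    (hl.2.2.1.trans Finset.sdiff_subset) (hl'.2.1.1.trans Finset.sdiff_subset)
    (hl'.2.2.1.trans Finset.sdiff_subset) h2
  obtain ⟨⟨A, B⟩, A₂, B₂⟩ := l
  obtain ⟨⟨A', B'⟩, A₂', B₂'⟩ := l'
  simp_all

lemma HasShape.unique {v : Fin n → ℤˣ} {i : Fin n} {q q' : ℕ × ℕ × ℕ × ℕ}
    {G : SimpleGraph (Fin n)} (h : HasShape v i q G) (h' : HasShape v i q' G) : q = q' := by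
  obtain ⟨l, hl, h⟩ := h
  obtain ⟨l', hl', h'⟩ := h'
  obtain rfl := HasLayers.unique hl hl' h h'
  rw [mem_layersOfShape] at hl hl'
  ext
  · exact hl.1.1.2.symm.trans hl'.1.1.2
  · exact hl.1.2.2.symm.trans hl'.1.2.2
  · exact hl.2.1.2.symm.trans hl'.2.1.2
  · exact hl.2.2.2.symm.trans hl'.2.2.2

/-- The two classes have `N` nodes each. -/
def ClassSize (v : Fin n → ℤˣ) (N : ℕ) : Prop :=
  ∀ i, (Finset.univ.filter fun k => v k = v i).card = N ∧
    (Finset.univ.filter fun k => v k ≠ v i).card = N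

lemma ClassSize.card_sameClass {v : Fin n → ℤˣ} {N : ℕ} (h : ClassSize v N) (i : Fin n) :
    (sameClass v i).card = N - 1 := by
  have : sameClass v i = (Finset.univ.filter fun k => v k = v i).erase i := by
    ext k; simp [sameClass, and_comm]
  rw [this, Finset.card_erase_of_mem (by simp), (h i).1]

lemma ClassSize.card_layersOfShape {v : Fin n → ℤˣ} {N : ℕ} (h : ClassSize v N) (i : Fin n)
    (q : ℕ × ℕ × ℕ × ℕ) :
    (layersOfShape v i q).card = (N - 1).choose q.1 * N.choose q.2.1 *
      ((N - 1 - q.1).choose q.2.2.1 * (N - q.2.1).choose q.2.2.2) := by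
  have h1 := h.card_sameClass i
  have h2 : (otherClass v i).card = N := (h i).2
  rw [layersOfShape, Finset.card_sigma, Finset.sum_const_nat
    (m := (N - 1 - q.1).choose q.2.2.1 * (N - q.2.1).choose q.2.2.2)]
  · simp [h1, h2]
  · intro x hx
    rw [Finset.mem_product, Finset.mem_powersetCard, Finset.mem_powersetCard] at hx
    rw [Finset.card_product, Finset.card_powersetCard, Finset.card_powersetCard,
      Finset.card_sdiff_of_subset hx.1.1, Finset.card_sdiff_of_subset hx.2.1, h1, h2,
      hx.1.2, hx.2.2]

/-- A lower bound for the probability that the two-step neighbourhood is a tree of shape `q`, when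
each class has `N` nodes and nodes are joined with probability `x` within and `y` between the
classes. -/
def shapeBound (N : ℕ) (x y : ℝ) (q : ℕ × ℕ × ℕ × ℕ) : ℝ :=
  ((N - 1).choose q.1 * N.choose q.2.1 *
      ((N - 1 - q.1).choose q.2.2.1 * (N - q.2.1).choose q.2.2.2) : ℕ) *
    (x ^ q.1 * y ^ q.2.1 * ((q.1 * x + q.2.1 * y) ^ q.2.2.1 * (q.1 * y + q.2.1 * x) ^ q.2.2.2) *
      ((1 - x) ^ N * (1 - y) ^ N) ^ (1 + q.1 + q.2.1))

lemma units_int_eq_of_ne {a b c : ℤˣ} (h : a ≠ c) (h' : b ≠ c) : a = b := by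
  rcases Int.units_eq_one_or a with rfl | rfl <;> rcases Int.units_eq_one_or b with rfl | rfl <;>
    rcases Int.units_eq_one_or c with rfl | rfl <;> simp_all

lemma hasLayers_prob_ge {p : Sym2 (Fin n) → unitInterval} {v : Fin n → ℤˣ} {N : ℕ}
    (hv : ClassSize v N) {x y : ℝ} (hp : ∀ j k, (p s(j, k) : ℝ) = if v j = v k then x else y)
    {i : Fin n} {q : ℕ × ℕ × ℕ × ℕ} {l : Layers n} (hl : l ∈ layersOfShape v i q) :
    x ^ q.1 * y ^ q.2.1 * ((q.1 * x + q.2.1 * y) ^ q.2.2.1 * (q.1 * y + q.2.1 * x) ^ q.2.2.2) *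
      ((1 - x) ^ N * (1 - y) ^ N) ^ (1 + q.1 + q.2.1) ≤
      (drawLaw p).real {ω | HasLayers (drawGraph ω) i l} := by
  rw [mem_layersOfShape] at hl
  obtain ⟨⟨A, B⟩, A₂, B₂⟩ := l
  obtain ⟨⟨⟨hA, hAc⟩, hB, hBc⟩, ⟨hA₂, hA₂c⟩, hB₂, hB₂c⟩ := hl
  simp only at hA hAc hB hBc hA₂ hA₂c hB₂ hB₂c
  have hd := disjoint_sameClass_otherClass v i
  have hA₂' := hA₂.trans Finset.sdiff_subset
  have hB₂' := hB₂.trans Finset.sdiff_subset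
  have hS : ∀ k ∈ sameClass v i, v k = v i ∧ k ≠ i := fun k hk => by simpa [sameClass] using hk
  have hO : ∀ k ∈ otherClass v i, v k ≠ v i := fun k hk => by simpa [otherClass] using hk
  have hAB : Disjoint A B := hd.mono hA hB
  have hAB₂ : Disjoint A₂ B₂ := hd.mono hA₂' hB₂'
  have hiS : i ∉ sameClass v i := fun h => (hS i h).2 rfl
  have hiO : i ∉ otherClass v i := fun h => hO i h rfl
  have hiR : i ∉ A ∪ B := by
    rw [Finset.mem_union]; rintro (h | h)
    exacts [hiS (hA h), hiO (hB h)]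
  have hiS₂ : i ∉ A₂ ∪ B₂ := by
    rw [Finset.mem_union]; rintro (h | h)
    exacts [hiS (hA₂' h), hiO (hB₂' h)]
  have hRS : Disjoint (A ∪ B) (A₂ ∪ B₂) := by
    rw [Finset.disjoint_union_left, Finset.disjoint_union_right, Finset.disjoint_union_right]
    exact ⟨⟨Finset.disjoint_sdiff.mono_right hA₂, hd.mono hA hB₂'⟩,
      (hd.mono hA₂' hB).symm, Finset.disjoint_sdiff.mono_right hB₂⟩
  refine le_trans (le_of_eq ?_) (localTree_prob_ge p hiR hiS₂ hRS)
  have e1 : ∏ k ∈ A ∪ B, (p s(i, k) : ℝ) = x ^ q.1 * y ^ q.2.1 := by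
    rw [Finset.prod_union hAB, ← hAc, ← hBc]
    congr 1
    · exact Finset.prod_eq_pow_card fun k hk => by rw [hp, if_pos (hS k (hA hk)).1.symm]
    · exact Finset.prod_eq_pow_card fun k hk => by rw [hp, if_neg (hO k (hB hk)).symm]
  have e2 : ∏ k ∈ A₂ ∪ B₂, ∑ j ∈ A ∪ B, (p s(j, k) : ℝ) =
      (q.1 * x + q.2.1 * y) ^ q.2.2.1 * (q.1 * y + q.2.1 * x) ^ q.2.2.2 := by
    rw [Finset.prod_union hAB₂, ← hA₂c, ← hB₂c]
    congr 1
    · refine Finset.prod_eq_pow_card fun k hk => ?_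
      have hk' := (hS k (hA₂' hk)).1
      rw [Finset.sum_union hAB, ← hAc, ← hBc, ← nsmul_eq_mul, ← nsmul_eq_mul]
      congr 1
      · exact Finset.sum_eq_card_nsmul fun j hj => by
          rw [hp, if_pos ((hS j (hA hj)).1.trans hk'.symm)]
      · exact Finset.sum_eq_card_nsmul fun j hj => by
          rw [hp, if_neg (hk' ▸ hO j (hB hj))]
    · refine Finset.prod_eq_pow_card fun k hk => ?_
      have hk' := hO k (hB₂' hk)
      rw [Finset.sum_union hAB, ← hAc, ← hBc, ← nsmul_eq_mul, ← nsmul_eq_mul]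
      congr 1
      · exact Finset.sum_eq_card_nsmul fun j hj => by
          rw [hp, if_neg ((hS j (hA hj)).1 ▸ hk'.symm)]
      · exact Finset.sum_eq_card_nsmul fun j hj => by
          rw [hp, if_pos (units_int_eq_of_ne (hO j (hB hj)) hk')]
  -- Here `w` runs over all nodes, `u` included, so every explored node contributes exactly `N`
  -- factors of each kind.
  have e3 : ∏ u ∈ insert i (A ∪ B), ∏ w, (1 - (p s(u, w) : ℝ)) =
      ((1 - x) ^ N * (1 - y) ^ N) ^ (1 + q.1 + q.2.1) := by
    have hc : (insert i (A ∪ B)).card = 1 + q.1 + q.2.1 := by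
      rw [Finset.card_insert_of_notMem hiR, Finset.card_union_of_disjoint hAB, hAc, hBc]; ring
    rw [← hc]
    refine Finset.prod_eq_pow_card fun u _ => ?_
    have : ∀ w, 1 - (p s(u, w) : ℝ) = if v w = v u then 1 - x else 1 - y := by
      intro w; rw [hp]; simp only [eq_comm (a := v u)]; split_ifs <;> rfl
    simp only [this, Finset.prod_ite, Finset.prod_const, (hv u).1]
    rw [(hv u).2]
  rw [e1, e2, e3]

lemma hasShape_prob_ge {p : Sym2 (Fin n) → unitInterval} {v : Fin n → ℤˣ} {N : ℕ}
    (hv : ClassSize v N) {x y : ℝ} (hp : ∀ j k, (p s(j, k) : ℝ) = if v j = v k then x else y)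
    (i : Fin n) (q : ℕ × ℕ × ℕ × ℕ) :
    shapeBound N x y q ≤ (drawLaw p).real {ω | HasShape v i q (drawGraph ω)} := by
  have hU : {ω | HasShape v i q (drawGraph ω)} =
      ⋃ l ∈ layersOfShape v i q, {ω | HasLayers (drawGraph ω) i l} := by
    ext ω; simp [HasShape]
  rw [hU, measureReal_biUnion_finset _ fun _ _ => MeasurableSet.of_discrete]
  · rw [shapeBound, ← hv.card_layersOfShape i q, ← nsmul_eq_mul]
    exact Finset.card_nsmul_le_sum _ _ _ fun l hl => hasLayers_prob_ge hv hp hl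
  · intro l hl l' hl' hne
    exact Set.disjoint_left.2 fun ω hω hω' => hne (HasLayers.unique hl hl' hω hω')

end TreeProbability

/-! ### The Gaussian computation given a tree neighbourhood. -/

section Noise

variable {n f : ℕ}

instance (s : ℝ) : IsProbabilityMeasure (noiseLaw n f s) := by
  have : IsProbabilityMeasure ((stdGaussian (Feat f)).map fun z => s • z) :=
    Measure.isProbabilityMeasure_map (by fun_prop)
  unfold noiseLaw
  infer_instance

lemma stdGaussian_map_smul_inner (s c : ℝ) {m : Feat f} (hm : ‖m‖ = 1) :
    (((stdGaussian (Feat f)).map fun z => s • z).map fun z => c * inner ℝ z m) =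
      gaussianReal 0 ((s * c) ^ 2).toNNReal := by
  set L : StrongDual ℝ (Feat f) := (s * c) • innerSL ℝ m
  have hL : ‖L‖ ^ 2 = (s * c) ^ 2 := by
    simp [L, norm_smul, hm, mul_pow]
  have h : ((fun z : Feat f => c * inner ℝ z m) ∘ fun z => s • z) = L := by
    ext z
    simp only [Function.comp_apply, real_inner_smul_left, real_inner_comm m z, L, smul_apply,
      innerSL_apply_apply, smul_eq_mul]
    ring
  rw [Measure.map_map (by fun_prop) (by fun_prop), h, IsGaussian.map_eq_gaussianReal,
    integral_strongDual_stdGaussian, variance_dual_stdGaussian, hL]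

lemma noiseLaw_map_sum (s : ℝ) {m : Feat f} (hm : ‖m‖ = 1) (w : Fin n → ℝ) :
    (noiseLaw n f s).map (fun z => ∑ k, w k * inner ℝ (z k) m) =
      gaussianReal 0 (s ^ 2 * ∑ k, w k ^ 2).toNNReal := by
  set ν := (stdGaussian (Feat f)).map fun z => s • z with hν
  have : IsProbabilityMeasure ν := Measure.isProbabilityMeasure_map (by fun_prop)
  set X : Fin n → Feat f → ℝ := fun k z => w k * inner ℝ z m
  have hX : ∀ k, Measurable (X k) := fun k => by fun_prop
  have hmap : ∀ k, ν.map (X k) = gaussianReal 0 ((s * w k) ^ 2).toNNReal := fun k =>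
    stdGaussian_map_smul_inner s (w k) hm
  have hG : ∀ k, HasGaussianLaw (X k) ν := fun k => ⟨by rw [hmap]; infer_instance⟩
  have hpi : ∀ k, (Measure.pi fun _ : Fin n => ν).map (fun z => X k (z k)) =
      gaussianReal 0 ((s * w k) ^ 2).toNNReal := fun k => by
    rw [← hmap k, ← (measurePreserving_eval (fun _ : Fin n => ν) k).map_eq,
      Measure.map_map (hX k) (measurable_pi_apply k)]
    simp only [(measurePreserving_eval (fun _ : Fin n => ν) k).map_eq]
    rfl
  have hind : iIndepFun (fun k z => X k (z k)) (Measure.pi fun _ : Fin n => ν) :=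
    iIndepFun_pi fun k => (hX k).aemeasurable
  have hG' : ∀ k, HasGaussianLaw (fun z => X k (z k)) (Measure.pi fun _ : Fin n => ν) :=
    fun k => ⟨by rw [hpi]; infer_instance⟩
  have hsum := hind.hasGaussianLaw_fun_sum hG'
  have hE : ∫ z, ∑ k, X k (z k) ∂(Measure.pi fun _ : Fin n => ν) = 0 := by
    rw [integral_finsetSum _ fun k _ => (hG' k).integrable]
    refine Finset.sum_eq_zero fun k _ => ?_
    have := integral_map (μ := Measure.pi fun _ : Fin n => ν) (φ := fun z => X k (z k))
      (f := fun x : ℝ => x) ((hX k).comp (measurable_pi_apply k)).aemeasurable (by fun_prop)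
    rw [hpi, integral_id_gaussianReal] at this
    exact this.symm
  have hV : Var[fun z => ∑ k, X k (z k); Measure.pi fun _ : Fin n => ν] =
      s ^ 2 * ∑ k, w k ^ 2 := by
    have := variance_sum_pi (μ := fun _ : Fin n => ν) (X := X) fun k => (hG k).memLp_two
    rw [Finset.sum_fn] at this
    rw [this, Finset.mul_sum]
    refine Finset.sum_congr rfl fun k _ => ?_
    have h2 := variance_map (μ := ν) (X := id) (Y := X k) (by fun_prop) (hX k).aemeasurable
    rw [hmap, variance_id_gaussianReal] at h2
    rw [Function.id_comp] at h2
    rw [← h2, Real.coe_toNNReal _ (sq_nonneg _), mul_pow]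
  have := hsum.map_eq_gaussianReal
  rw [hE, hV] at this
  exact this

lemma noiseLaw_real_lt {s : ℝ} {m : Feat f} (hm : ‖m‖ = 1) {w : Fin n → ℝ}
    (hw : s ^ 2 * ∑ k, w k ^ 2 = 1) (t : ℝ) :
    (noiseLaw n f s).real {z | ∑ k, w k * inner ℝ (z k) m < t} = Phi t := by
  have h := noiseLaw_map_sum (n := n) s hm w
  rw [hw, Real.toNNReal_one] at h
  rw [Phi, cdf_eq_real, ← h]
  -- Without atoms the strict inequality has the same probability as the weak one defining the cdf.
  have hn : NullSingletonClass (gaussianReal 0 1) := nullSingletonClass_gaussianReal one_ne_zero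
  rw [← h] at hn
  rw [← measureReal_congr (Iio_ae_eq_Iic (μ := (noiseLaw n f s).map _)),
    map_measureReal_apply (by fun_prop) measurableSet_Iio]
  rfl

/-- Relative to `v i` the layers contribute `1 + a + b`, `2 (a - b)` and `a₂ - b₂`, which add up to
the numerator of `psi`. -/
lemma sum_treeWeight_label {G : SimpleGraph (Fin n)} {v : Fin n → ℤˣ} {i : Fin n}
    {q : ℕ × ℕ × ℕ × ℕ} {l : Layers n} (hl : l ∈ layersOfShape v i q) (h : HasLayers G i l) :
    ∑ k, treeWeight i (l.1.1 ∪ l.1.2) (l.2.1 ∪ l.2.2) k * ((v k : ℤ) : ℝ) =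
      ((v i : ℤ) : ℝ) * (1 + 3 * (q.1 : ℝ) - q.2.1 + q.2.2.1 - q.2.2.2) := by
  rw [mem_layersOfShape] at hl
  obtain ⟨⟨A, B⟩, A₂, B₂⟩ := l
  obtain ⟨⟨⟨hA, hAc⟩, hB, hBc⟩, ⟨hA₂, hA₂c⟩, hB₂, hB₂c⟩ := hl
  simp only at hA hAc hB hBc hA₂ hA₂c hB₂ hB₂c
  have hd := disjoint_sameClass_otherClass v i
  replace hA₂ := hA₂.trans Finset.sdiff_subset
  replace hB₂ := hB₂.trans Finset.sdiff_subset
  have hS : ∀ k ∈ sameClass v i, ((v k : ℤ) : ℝ) = ((v i : ℤ) : ℝ) := fun k hk => by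
    simp only [sameClass, Finset.mem_filter, Finset.mem_univ, true_and] at hk
    rw [hk.1]
  have hO : ∀ k ∈ otherClass v i, ((v k : ℤ) : ℝ) = -((v i : ℤ) : ℝ) := fun k hk => by
    simp only [otherClass, Finset.mem_filter, Finset.mem_univ, true_and] at hk
    rcases Int.units_eq_one_or (v k) with h1 | h1 <;>
      rcases Int.units_eq_one_or (v i) with h2 | h2 <;> simp_all
  have hsum : ∀ C D : Finset (Fin n), C ⊆ sameClass v i → D ⊆ otherClass v i →
      ∑ k ∈ C ∪ D, ((v k : ℤ) : ℝ) = ((v i : ℤ) : ℝ) * (C.card - D.card) := by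
    intro C D hC hD
    rw [Finset.sum_union (hd.mono hC hD), Finset.sum_congr rfl fun k hk => hS k (hC hk),
      Finset.sum_congr rfl fun k hk => hO k (hD hk)]
    simp
    ring
  obtain ⟨hi, hdis, φ, hφ, hE⟩ := h
  have hlay := sum_layers hE.notMem hi hdis
    (fun k => (1 + ((A ∪ B).card : ℝ)) * ((v k : ℤ) : ℝ)) (fun k => 2 * ((v k : ℤ) : ℝ))
    (fun k => 1 * ((v k : ℤ) : ℝ))
  simp only [treeWeight, ite_mul, zero_mul]
  rw [hlay, ← Finset.mul_sum, ← Finset.mul_sum, hsum A B hA hB, hsum A₂ B₂ hA₂ hB₂,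
    Finset.card_union_of_disjoint (hd.mono hA hB), hAc, hBc, hA₂c, hB₂c]
  push_cast
  ring

lemma sum_treeWeight_sq_of_hasLayers {G : SimpleGraph (Fin n)} {v : Fin n → ℤˣ} {i : Fin n}
    {q : ℕ × ℕ × ℕ × ℕ} {l : Layers n} (hl : l ∈ layersOfShape v i q) (h : HasLayers G i l) :
    ∑ k, treeWeight i (l.1.1 ∪ l.1.2) (l.2.1 ∪ l.2.2) k ^ 2 =
      ((q.1 : ℝ) + q.2.1 + 1) ^ 2 + 4 * ((q.1 : ℝ) + q.2.1) + ((q.2.2.1 : ℝ) + q.2.2.2) := by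
  rw [LocalTree.sum_treeWeight_sq h]
  rw [mem_layersOfShape] at hl
  have hd := disjoint_sameClass_otherClass v i
  rw [Finset.card_union_of_disjoint (hd.mono hl.1.1.1 hl.1.2.1),
    Finset.card_union_of_disjoint (hd.mono (hl.2.1.1.trans Finset.sdiff_subset)
      (hl.2.2.1.trans Finset.sdiff_subset)), hl.1.1.2, hl.1.2.2, hl.2.1.2, hl.2.2.2]
  push_cast
  rfl

/-- `Real.sign 0 = 0` is not a label, hence the strict inequality. -/
lemma sign_eq_unit_iff (u : ℤˣ) (r : ℝ) : Real.sign r = ((u : ℤ) : ℝ) ↔ 0 < ((u : ℤ) : ℝ) * r := by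
  rcases Int.units_eq_one_or u with rfl | rfl <;> rcases lt_trichotomy r 0 with h | h | h
  · norm_num [Real.sign_of_neg h, h.le]
  · simp [h]
  · simp [Real.sign_of_pos h, h]
  · simp [Real.sign_of_neg h, h]
  · simp [h]
  · norm_num [Real.sign_of_pos h, h.le]

/-- The features of the nodes with labels `v` and noise `z`. -/
def features (μ : ℝ) (m : Feat f) (v : Fin n → ℤˣ) (z : Fin n → Feat f) : Fin n → Feat f :=
  fun k => (((v k : ℤ) : ℝ) * μ) • m + z k

lemma HasShape.noise_correct {μ s K : ℝ} {m : Feat f} (hs : 0 < s) (hK : K ≠ 0) (hm : ‖m‖ = 1)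
    {G : SimpleGraph (Fin n)} {v : Fin n → ℤˣ} {i : Fin n} {q : ℕ × ℕ × ℕ × ℕ}
    (h : HasShape v i q G) :
    (noiseLaw n f s).real {z | Real.sign (linearGCN K m (G, i, v, features μ m v z)) =
        ((v i : ℤ) : ℝ)} =
      Phi (psi (Real.sign K * (μ / s)) q.1 q.2.1 q.2.2.1 q.2.2.2) := by
  obtain ⟨l, hl, h⟩ := h
  have hmean := sum_treeWeight_label hl h
  have hsq := sum_treeWeight_sq_of_hasLayers hl h
  rw [psi]
  set w := treeWeight i (l.1.1 ∪ l.1.2) (l.2.1 ∪ l.2.2)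
  set M : ℝ := 1 + 3 * (q.1 : ℝ) - q.2.1 + q.2.2.1 - q.2.2.2
  set D : ℝ := ((q.1 : ℝ) + q.2.1 + 1) ^ 2 + 4 * ((q.1 : ℝ) + q.2.1) +
    ((q.2.2.1 : ℝ) + q.2.2.2)
  have hD : 0 < D := by positivity
  have hy : ∀ z, linearGCN K m (G, i, v, features μ m v z) =
      K * (μ * (((v i : ℤ) : ℝ) * M) + ∑ k, w k * inner ℝ (z k) m) := by
    intro z
    have hin : ∀ k, inner ℝ (features μ m v z k) m = ((v k : ℤ) : ℝ) * μ + inner ℝ (z k) m := by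
      intro k
      rw [features, inner_add_left, real_inner_smul_left, real_inner_self_eq_norm_sq, hm]
      ring
    have := LocalTree.sum_nbhd h fun k => inner ℝ (features μ m v z k) m
    simp only [linearGCN, Sample.graph, Sample.node, Sample.feature]
    rw [this, ← hmean, Finset.mul_sum _ _ μ, ← Finset.sum_add_distrib]
    congr 1
    refine Finset.sum_congr rfl fun k _ => ?_
    rw [hin]
    ring
  set u : ℝ := ((v i : ℤ) : ℝ) with hu
  have hu2 : u * u = 1 := by
    rcases Int.units_eq_one_or (v i) with h | h <;> simp [hu, h]
  set σ := Real.sign K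
  have hσ2 : σ * σ = 1 := by
    rcases hK.lt_or_gt with h | h <;> simp [σ, Real.sign_of_neg, Real.sign_of_pos, h]
  have hσK : K = σ * |K| := by
    rcases hK.lt_or_gt with h | h <;>
      simp [σ, Real.sign_of_neg, Real.sign_of_pos, h, abs_of_neg, abs_of_pos]
  have hsD : 0 < s * √D := mul_pos hs (Real.sqrt_pos.2 hD)
  -- The factor `1 / (s * √D)` makes the variance 1, and `-(u * σ)` turns positivity of `u * y` into
  -- an upper bound on the noise.
  have hkey := noiseLaw_real_lt (n := n) (s := s) hm
    (w := fun k => -(u * σ) / (s * √D) * w k) ?_ (σ * (μ / s) * (M / √D))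
  · rw [← hkey]
    congr 1
    ext z
    simp only [Set.mem_ofPred_eq]
    rw [sign_eq_unit_iff, hy, ← hu]
    have e1 : ∑ k, -(u * σ) / (s * √D) * w k * inner ℝ (z k) m =
        (s * √D)⁻¹ * (-(u * σ) * ∑ k, w k * inner ℝ (z k) m) := by
      rw [Finset.mul_sum, Finset.mul_sum]
      exact Finset.sum_congr rfl fun k _ => by ring
    have e2 : σ * (μ / s) * (M / √D) = (s * √D)⁻¹ * (σ * μ * M) := by
      field_simp
    rw [e1, e2, mul_lt_mul_iff_right₀ (inv_pos.2 hsD)]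
    set Z := ∑ k, w k * inner ℝ (z k) m
    have e3 : u * (K * (μ * (u * M) + Z)) = |K| * (σ * μ * M + u * σ * Z) := by
      rw [hσK, abs_mul, abs_abs]
      have : |σ| = 1 := by
        have := abs_mul_abs_self σ
        nlinarith [abs_nonneg σ]
      rw [this]
      linear_combination (|K| * σ * μ * M) * hu2
    rw [e3, mul_pos_iff_of_pos_left (abs_pos.2 hK)]
    constructor <;> intro h <;> linarith
  · have : ∀ k, (-(u * σ) / (s * √D) * w k) ^ 2 = (s ^ 2 * D)⁻¹ * w k ^ 2 := by
      intro k
      rw [mul_pow, div_pow, mul_pow, Real.sq_sqrt hD.le]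
      have : (-(u * σ)) ^ 2 = 1 := by linear_combination (σ * σ) * hu2 + hσ2
      rw [this, one_div]
    simp only [this]
    rw [← Finset.mul_sum, hsq]
    field_simp

end Noise

/-! ### Poisson limits and the squeeze argument. -/

section Limit

lemma tendsto_choose_sub_mul_pow (c k : ℕ) (r : ℝ) :
    Tendsto (fun N : ℕ => ((N - c).choose k : ℝ) * (r / N) ^ k) atTop
      (𝓝 (r ^ k / k.factorial)) := by
  rw [← tendsto_add_atTop_iff_nat c]
  simp only [Nat.add_sub_cancel]
  refine tendsto_choose_mul_pow_atTop k ?_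
  have h : Tendsto (fun N : ℕ => (N : ℝ) / (N + c)) atTop (𝓝 1) := by
    simpa using tendsto_natCast_div_add_atTop (𝕜 := ℝ) (c : ℝ)
  simpa [mul_div_assoc, mul_comm, mul_left_comm, div_eq_mul_inv] using h.mul_const r

lemma tendsto_one_sub_div_pow (r : ℝ) :
    Tendsto (fun N : ℕ => (1 - r / N) ^ N) atTop (𝓝 (Real.exp (-r))) := by
  simpa [sub_eq_add_neg, neg_div] using Real.tendsto_one_add_div_pow_exp (-r)

lemma tendsto_shapeBound (d lam : ℝ) (q : ℕ × ℕ × ℕ × ℕ) :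
    Tendsto (fun N : ℕ => shapeBound N (dIn d lam / N) (dOut d lam / N) q) atTop
      (𝓝 (countProb d lam q.1 q.2.1 q.2.2.1 q.2.2.2)) := by
  obtain ⟨a, b, a₂, b₂⟩ := q
  set x := dIn d lam
  set y := dOut d lam
  have h := (((tendsto_choose_sub_mul_pow 1 a x).mul (tendsto_choose_sub_mul_pow 0 b y)).mul
    ((tendsto_choose_sub_mul_pow (1 + a) a₂ (a * x + b * y)).mul
      (tendsto_choose_sub_mul_pow b b₂ (a * y + b * x)))).mul
    (((tendsto_one_sub_div_pow x).mul (tendsto_one_sub_div_pow y)).pow (1 + a + b))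
  refine (h.congr fun N => ?_).trans_eq ?_
  · simp only [shapeBound, Nat.sub_sub, Nat.sub_zero]
    have e1 : (a : ℝ) * (x / N) + b * (y / N) = (a * x + b * y) / N := by ring
    have e2 : (a : ℝ) * (y / N) + b * (x / N) = (a * y + b * x) / N := by ring
    rw [e1, e2]
    push_cast
    ring
  · congr 1
    simp only [countProb, poissonPmf]
    -- One copy of `exp (-x) * exp (-y)` normalises the first layer; the other `a + b` copies
    -- regroup into the normalisations of the second.
    have : (Real.exp (-x) * Real.exp (-y)) ^ (1 + a + b) = Real.exp (-x) * Real.exp (-y) *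
        Real.exp (-(x * a + y * b)) * Real.exp (-(y * a + x * b)) := by
      rw [← Real.exp_add, ← Real.exp_nat_mul, ← Real.exp_add, ← Real.exp_add]
      congr 1
      push_cast
      ring
    rw [this]
    ring

lemma hasSum_poissonPmf {r : ℝ} (hr : 0 ≤ r) : HasSum (fun k => poissonPmf k r) 1 := by
  simpa [poissonPmf, mul_comm, hr] using hasSum_one_poissonMeasure r.toNNReal

lemma poissonPmf_nonneg {r : ℝ} (hr : 0 ≤ r) (k : ℕ) : 0 ≤ poissonPmf k r := by
  unfold poissonPmf; positivity

lemma dIn_nonneg {d lam : ℝ} (hd : 0 ≤ d) (hlam : |lam| ≤ √d) : 0 ≤ dIn d lam := by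
  have := (abs_le.1 hlam).1
  have h := Real.mul_self_sqrt hd
  unfold dIn
  nlinarith [Real.sqrt_nonneg d]

lemma dOut_nonneg {d lam : ℝ} (hd : 0 ≤ d) (hlam : |lam| ≤ √d) : 0 ≤ dOut d lam := by
  have := (abs_le.1 hlam).2
  have h := Real.mul_self_sqrt hd
  unfold dOut
  nlinarith [Real.sqrt_nonneg d]

/-- Attaching a conditional probability mass function preserves total mass (Tonelli). It is needed
because the Poisson parameters of the second layer depend on the first. -/
lemma hasSum_mul_of_hasSum_fiber_one {α β : Type*} {f : α → ℝ} {g : α → β → ℝ} {c : ℝ}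
    (hf : HasSum f c) (hf0 : ∀ a, 0 ≤ f a) (hg0 : ∀ a b, 0 ≤ g a b)
    (hg : ∀ a, HasSum (g a) 1) : HasSum (fun x : α × β => f x.1 * g x.1 x.2) c := by
  have hfib : ∀ a, HasSum (fun b => f a * g a b) (f a) := fun a => by
    simpa using (hg a).mul_left (f a)
  have hs : Summable fun x : α × β => f x.1 * g x.1 x.2 := by
    rw [summable_prod_of_nonneg fun x => mul_nonneg (hf0 _) (hg0 _ _)]
    refine ⟨fun a => (hfib a).summable, ?_⟩
    simpa only [(hfib _).tsum_eq] using hf.summable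
  have := hs.hasSum.prod_fiberwise fun a => hfib a
  rw [← this.unique hf]
  exact hs.hasSum

lemma countProb_nonneg {d lam : ℝ} (hd : 0 ≤ d) (hlam : |lam| ≤ √d) (a b a₂ b₂ : ℕ) :
    0 ≤ countProb d lam a b a₂ b₂ := by
  have h1 := dIn_nonneg hd hlam
  have h2 := dOut_nonneg hd hlam
  refine mul_nonneg (mul_nonneg (mul_nonneg ?_ ?_) ?_) ?_ <;>
    exact poissonPmf_nonneg (by positivity) _

lemma hasSum_countProb {d lam : ℝ} (hd : 0 ≤ d) (hlam : |lam| ≤ √d) :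
    HasSum (fun q : ℕ × ℕ × ℕ × ℕ => countProb d lam q.1 q.2.1 q.2.2.1 q.2.2.2) 1 := by
  have h1 := dIn_nonneg hd hlam
  have h2 := dOut_nonneg hd hlam
  have h3 : ∀ a b : ℕ, 0 ≤ dIn d lam * a + dOut d lam * b := fun a b => by positivity
  have h4 : ∀ a b : ℕ, 0 ≤ dOut d lam * a + dIn d lam * b := fun a b => by positivity
  have s1 : HasSum (fun x : ℕ × ℕ => poissonPmf x.1 (dIn d lam) * poissonPmf x.2 (dOut d lam)) 1 :=
    hasSum_mul_of_hasSum_fiber_one (hasSum_poissonPmf h1) (poissonPmf_nonneg h1)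
      (g := fun _ b => poissonPmf b (dOut d lam)) (fun _ => poissonPmf_nonneg h2)
      fun _ => hasSum_poissonPmf h2
  have n1 : ∀ x : ℕ × ℕ, 0 ≤ poissonPmf x.1 (dIn d lam) * poissonPmf x.2 (dOut d lam) :=
    fun x => mul_nonneg (poissonPmf_nonneg h1 x.1) (poissonPmf_nonneg h2 x.2)
  have n2 : ∀ x : (ℕ × ℕ) × ℕ, 0 ≤ poissonPmf x.1.1 (dIn d lam) * poissonPmf x.1.2 (dOut d lam) *
      poissonPmf x.2 (dIn d lam * x.1.1 + dOut d lam * x.1.2) :=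
    fun x => mul_nonneg (n1 x.1) (poissonPmf_nonneg (h3 x.1.1 x.1.2) x.2)
  have s2 : HasSum (fun x : (ℕ × ℕ) × ℕ => poissonPmf x.1.1 (dIn d lam) *
      poissonPmf x.1.2 (dOut d lam) * poissonPmf x.2 (dIn d lam * x.1.1 + dOut d lam * x.1.2)) 1 :=
    hasSum_mul_of_hasSum_fiber_one
      (f := fun x : ℕ × ℕ => poissonPmf x.1 (dIn d lam) * poissonPmf x.2 (dOut d lam))
      (g := fun x k => poissonPmf k (dIn d lam * x.1 + dOut d lam * x.2))
      s1 n1 (fun x k => poissonPmf_nonneg (h3 x.1 x.2) k) fun x => hasSum_poissonPmf (h3 x.1 x.2)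
  have s3 : HasSum (fun x : ((ℕ × ℕ) × ℕ) × ℕ => poissonPmf x.1.1.1 (dIn d lam) *
      poissonPmf x.1.1.2 (dOut d lam) *
      poissonPmf x.1.2 (dIn d lam * x.1.1.1 + dOut d lam * x.1.1.2) *
      poissonPmf x.2 (dOut d lam * x.1.1.1 + dIn d lam * x.1.1.2)) 1 :=
    hasSum_mul_of_hasSum_fiber_one
      (f := fun x : (ℕ × ℕ) × ℕ => poissonPmf x.1.1 (dIn d lam) * poissonPmf x.1.2 (dOut d lam) *
        poissonPmf x.2 (dIn d lam * x.1.1 + dOut d lam * x.1.2))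
      (g := fun x k => poissonPmf k (dOut d lam * x.1.1 + dIn d lam * x.1.2))
      s2 n2 (fun x k => poissonPmf_nonneg (h4 x.1.1 x.1.2) k)
      fun x => hasSum_poissonPmf (h4 x.1.1 x.1.2)
  refine (((Equiv.prodAssoc (ℕ × ℕ) ℕ ℕ).trans (Equiv.prodAssoc ℕ ℕ (ℕ × ℕ))).hasSum_iff).1 ?_
  simpa only [Function.comp_def, Equiv.trans_apply, Equiv.prodAssoc_apply, countProb] using s3

/-- A sequence that is asymptotically bounded below by all finite partial sums of
`∑ c φ`, and whose distance to `1` is so bounded by those of `∑ c (1 - φ)`, converges to `∑ c φ`,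
if `∑ c = 1`. -/
lemma tendsto_of_sum_le {ι : Type*} {c φ : ι → ℝ} {b : ℕ → ι → ℝ} {u : ℕ → ℝ} {L : ℝ}
    (hc : HasSum c 1) (hL : HasSum (fun q => c q * φ q) L)
    (hb : ∀ q, Tendsto (fun N => b N q) atTop (𝓝 (c q)))
    (h1 : ∀ Q : Finset ι, ∀ᶠ N in atTop, ∑ q ∈ Q, b N q * φ q ≤ u N)
    (h2 : ∀ Q : Finset ι, ∀ᶠ N in atTop, ∑ q ∈ Q, b N q * (1 - φ q) ≤ 1 - u N) :
    Tendsto u atTop (𝓝 L) := by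
  -- The first bound gives `liminf u ≥ L`; the complementary series, of sum `1 - L`, gives `limsup u
  -- ≤ L`.
  have hL' : HasSum (fun q => c q * (1 - φ q)) (1 - L) := by
    simpa [mul_sub] using hc.sub hL
  rw [tendsto_order]
  constructor
  · intro l hl
    obtain ⟨Q, hQ⟩ := (hL.eventually (lt_mem_nhds hl)).exists
    have : Tendsto (fun N => ∑ q ∈ Q, b N q * φ q) atTop (𝓝 (∑ q ∈ Q, c q * φ q)) :=
      tendsto_finsetSum _ fun q _ => (hb q).mul_const _
    filter_upwards [this.eventually (lt_mem_nhds hQ), h1 Q] with N h h' using h.trans_le h'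
  · intro l hl
    obtain ⟨Q, hQ⟩ := (hL'.eventually (lt_mem_nhds (sub_lt_sub_left hl 1))).exists
    have : Tendsto (fun N => ∑ q ∈ Q, b N q * (1 - φ q)) atTop
        (𝓝 (∑ q ∈ Q, c q * (1 - φ q))) :=
      tendsto_finsetSum _ fun q _ => (hb q).mul_const _
    filter_upwards [this.eventually (lt_mem_nhds hQ), h2 Q] with N h h'
    linarith

end Limit

/-! ### Measurability of the event of a correct prediction. -/

section Measurability

variable {n f : ℕ}

instance : DiscreteMeasurableSpace (SimpleGraph (Fin n)) where
  forall_measurableSet s := by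
    rw [← Set.preimage_image_eq s SimpleGraph.adj_injective]
    exact SimpleGraph.measurable_adj MeasurableSet.of_discrete

instance : DiscreteMeasurableSpace ℤˣ where
  forall_measurableSet s := by
    rw [← Set.preimage_image_eq s Units.val_injective]
    exact (comap_measurable _) MeasurableSet.of_discrete

lemma measurable_of_measurable_feature {g : Sample n f → ℝ}
    (hg : ∀ G i v, Measurable fun X => g (G, i, v, X)) : Measurable g :=
  measurable_from_prod_countable_right fun G => measurable_from_prod_countable_right fun i =>
    measurable_from_prod_countable_right fun v => hg G i v

lemma measurableSet_correct (K : ℝ) (m : Feat f) :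
    MeasurableSet {x : Sample n f | Real.sign (linearGCN K m x) = ((x.label x.node : ℤ) : ℝ)} := by
  simp only [sign_eq_unit_iff]
  refine measurableSet_lt measurable_const (measurable_of_measurable_feature fun G i v => ?_)
  simp only [linearGCN, Sample.graph, Sample.node, Sample.label, Sample.feature]
  fun_prop

end Measurability

/-! ### Lower bounds given the base node and the labels. -/

section Conditional

variable {n f : ℕ}

instance (d lam : ℝ) (v : Fin n → ℤˣ) : IsProbabilityMeasure (graphLaw d lam v) :=
  Measure.isProbabilityMeasure_map Measurable.of_discrete.aemeasurable

lemma graphLaw_real_hasShape_ge {d lam x y : ℝ} {v : Fin n → ℤˣ} {N : ℕ} (hv : ClassSize v N)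
    (hp : ∀ j k, (edgeProb d lam v s(j, k) : ℝ) = if v j = v k then x else y) (i : Fin n)
    (q : ℕ × ℕ × ℕ × ℕ) :
    shapeBound N x y q ≤ (graphLaw d lam v).real {G | HasShape v i q G} := by
  rw [graphLaw, map_measureReal_apply Measurable.of_discrete MeasurableSet.of_discrete]
  exact hasShape_prob_ge hv hp i q

/-- The law of the sample given the base node and the labels. -/
def sampleLaw (d lam μ s : ℝ) (m : Feat f) (iv : Fin n × (Fin n → ℤˣ)) : Measure (Sample n f) :=
  ((graphLaw d lam iv.2).prod (noiseLaw n f s)).map fun Gz =>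
    (Gz.1, iv.1, iv.2, features μ m iv.2 Gz.2)

lemma measurable_sample (μ : ℝ) (m : Feat f) (iv : Fin n × (Fin n → ℤˣ)) :
    Measurable fun Gz : SimpleGraph (Fin n) × (Fin n → Feat f) =>
      ((Gz.1, iv.1, iv.2, features μ m iv.2 Gz.2) : Sample n f) := by
  unfold features
  fun_prop

instance (d lam μ s : ℝ) (m : Feat f) (iv : Fin n × (Fin n → ℤˣ)) :
    IsProbabilityMeasure (sampleLaw d lam μ s m iv) :=
  Measure.isProbabilityMeasure_map (measurable_sample μ m iv).aemeasurable

/-- Integrate the noise first: on a graph of shape `q` the inner probability of `C` is at least `t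
q`, and elsewhere 0 suffices. -/
lemma sampleLaw_ge {d lam μ s x y : ℝ} {m : Feat f} {iv : Fin n × (Fin n → ℤˣ)} {N : ℕ}
    (hv : ClassSize iv.2 N)
    (hp : ∀ j k, (edgeProb d lam iv.2 s(j, k) : ℝ) = if iv.2 j = iv.2 k then x else y)
    {C : Set (Sample n f)} (hC : MeasurableSet C) {t : ℕ × ℕ × ℕ × ℕ → ℝ} (ht : ∀ q, 0 ≤ t q)
    (h : ∀ q G, HasShape iv.2 iv.1 q G →
      t q ≤ (noiseLaw n f s).real {z | (G, iv.1, iv.2, features μ m iv.2 z) ∈ C})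
    (Q : Finset (ℕ × ℕ × ℕ × ℕ)) :
    ENNReal.ofReal (∑ q ∈ Q, shapeBound N x y q * t q) ≤ sampleLaw d lam μ s m iv C := by
  classical
  have hmeas := measurable_sample μ m iv
  rw [sampleLaw, Measure.map_apply hmeas hC, Measure.prod_apply (hmeas hC)]
  calc ENNReal.ofReal (∑ q ∈ Q, shapeBound N x y q * t q)
      ≤ ∑ q ∈ Q, ENNReal.ofReal (t q) * graphLaw d lam iv.2 {G | HasShape iv.2 iv.1 q G} := by
        have hr : ∀ q, ENNReal.ofReal (t q) * graphLaw d lam iv.2 {G | HasShape iv.2 iv.1 q G} =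
            ENNReal.ofReal (t q * (graphLaw d lam iv.2).real {G | HasShape iv.2 iv.1 q G}) := by
          intro q
          rw [ENNReal.ofReal_mul (ht q), ofReal_measureReal]
        simp only [hr]
        rw [← ENNReal.ofReal_sum_of_nonneg fun q _ => mul_nonneg (ht q) measureReal_nonneg]
        refine ENNReal.ofReal_le_ofReal (Finset.sum_le_sum fun q _ => ?_)
        rw [mul_comm]
        exact mul_le_mul_of_nonneg_left (graphLaw_real_hasShape_ge hv hp iv.1 q) (ht q)
    _ = ∫⁻ G, ∑ q ∈ Q, {G | HasShape iv.2 iv.1 q G}.indicator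
          (fun _ => ENNReal.ofReal (t q)) G ∂(graphLaw d lam iv.2) := by
        rw [lintegral_finsetSum _ fun _ _ => Measurable.of_discrete]
        exact Finset.sum_congr rfl fun q _ =>
          (lintegral_indicator_const MeasurableSet.of_discrete _).symm
    _ ≤ _ := by
        refine lintegral_mono fun G => ?_
        simp only [Set.indicator_apply, Set.mem_ofPred_eq]
        by_cases hG : ∃ q ∈ Q, HasShape iv.2 iv.1 q G
        · obtain ⟨q, hq, hG⟩ := hG
          -- A graph has at most one shape, so a single indicator survives.
          rw [Finset.sum_eq_single_of_mem q hq fun q' _ hne =>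
            if_neg fun h' => hne (HasShape.unique h' hG), if_pos hG]
          exact ENNReal.ofReal_le_of_le_toReal (h q G hG)
        · push Not at hG
          rw [Finset.sum_eq_zero fun q hq => if_neg (hG q hq)]
          exact zero_le

end Conditional

/-! ### Averaging over the base node and the balanced labellings. -/

section Average

variable {f : ℕ}

lemma Balanced.classSize {N : ℕ} {v : Fin (2 * N) → ℤˣ} (h : Balanced v) : ClassSize v N := by
  classical
  have h1 : (Finset.univ.filter fun k => v k = 1).card =
      (Finset.univ.filter fun k => v k = -1).card := by
    simpa [Balanced, Nat.card_eq_fintype_card, Fintype.card_subtype] using h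
  have hne : ∀ k, v k ≠ 1 ↔ v k = -1 := fun k => by
    rcases Int.units_eq_one_or (v k) with h | h <;> simp [h]
  have hne' : ∀ k, v k ≠ -1 ↔ v k = 1 := fun k => by
    rw [ne_eq, ← hne, not_not]
  have h2 := Finset.card_filter_add_card_filter_not (s := Finset.univ) fun k => v k = 1
  simp only [hne, Finset.card_univ, Fintype.card_fin] at h2
  intro i
  rcases Int.units_eq_one_or (v i) with h | h <;> simp only [h, hne, hne'] <;> omega

/-- Ensures that the uniform law is conditioned on a nonempty set; otherwise it would be the zero
measure. -/
lemma exists_balanced (N : ℕ) : ∃ v : Fin (2 * N) → ℤˣ, Balanced v := by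
  let e : Fin (2 * N) ≃ Fin N ⊕ Fin N := (finCongr (two_mul N)).trans finSumFinEquiv.symm
  have hcard : ∀ u : ℤˣ, ∀ w : Fin N ⊕ Fin N → ℤˣ,
      Nat.card {k // w (e k) = u} = Nat.card {k // w k = u} := fun u w =>
    Nat.card_congr (e.subtypeEquiv fun _ => Iff.rfl)
  refine ⟨fun k => Sum.elim (fun _ => 1) (fun _ => -1) (e k), ?_⟩
  rw [Balanced, hcard 1 (Sum.elim _ _), hcard (-1) (Sum.elim _ _)]
  refine Nat.card_congr ((Equiv.sumComm _ _).subtypeEquiv fun k => ?_)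
  rcases k with k | k <;> simp

lemma edgeProb_eq {d lam : ℝ} {N : ℕ} (h1 : dIn d lam / N ∈ Set.Icc (0 : ℝ) 1)
    (h2 : dOut d lam / N ∈ Set.Icc (0 : ℝ) 1) (v : Fin (2 * N) → ℤˣ) (j k : Fin (2 * N)) :
    (edgeProb d lam v s(j, k) : ℝ) = if v j = v k then dIn d lam / N else dOut d lam / N := by
  have e1 : (d + lam * √d) / ((2 * N : ℕ) : ℝ) = dIn d lam / N := by
    rw [dIn, div_div]; push_cast; rfl
  have e2 : (d - lam * √d) / ((2 * N : ℕ) : ℝ) = dOut d lam / N := by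
    rw [dOut, div_div]; push_cast; rfl
  simp only [edgeProb, Sym2.map_mk, Sym2.mk_isDiag_iff, e1, e2]
  split_ifs
  · rw [Set.projIcc_of_mem zero_le_one h1]
  · rw [Set.projIcc_of_mem zero_le_one h2]

lemma isProbabilityMeasure_uniformOn_balanced {N : ℕ} (hN : 0 < N) :
    IsProbabilityMeasure
      (uniformOn {iv : Fin (2 * N) × (Fin (2 * N) → ℤˣ) | Balanced iv.2}) := by
  obtain ⟨v, hv⟩ := exists_balanced N
  exact isProbabilityMeasure_uniformOn (Set.toFinite _) ⟨(⟨0, by omega⟩, v), hv⟩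

lemma csbm_apply (N : ℕ) (d lam μ s : ℝ) (m : Feat f) {C : Set (Sample (2 * N) f)}
    (hC : MeasurableSet C) :
    csbm (2 * N) d lam μ s m C = ∫⁻ iv, sampleLaw d lam μ s m iv C
      ∂(uniformOn {iv : Fin (2 * N) × (Fin (2 * N) → ℤˣ) | Balanced iv.2}) :=
  Measure.bind_apply hC Measurable.of_discrete.aemeasurable

lemma isProbabilityMeasure_csbm {N : ℕ} (hN : 0 < N) (d lam μ s : ℝ) (m : Feat f) :
    IsProbabilityMeasure (csbm (2 * N) d lam μ s m) := by
  have := isProbabilityMeasure_uniformOn_balanced hN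
  exact ⟨by rw [csbm_apply _ _ _ _ _ _ MeasurableSet.univ]; simp⟩

/-- The conditional bound is the same for every base node and balanced labelling, so it survives
averaging unchanged. -/
lemma csbm_real_ge {N : ℕ} (hN : 0 < N) {d lam μ s : ℝ} {m : Feat f}
    (h1 : dIn d lam / N ∈ Set.Icc (0 : ℝ) 1) (h2 : dOut d lam / N ∈ Set.Icc (0 : ℝ) 1)
    {C : Set (Sample (2 * N) f)} (hC : MeasurableSet C) {t : ℕ × ℕ × ℕ × ℕ → ℝ}
    (ht : ∀ q, 0 ≤ t q)
    (h : ∀ i v q G, HasShape v i q G →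
      t q ≤ (noiseLaw (2 * N) f s).real {z | (G, i, v, features μ m v z) ∈ C})
    (Q : Finset (ℕ × ℕ × ℕ × ℕ)) :
    ∑ q ∈ Q, shapeBound N (dIn d lam / N) (dOut d lam / N) q * t q ≤
      (csbm (2 * N) d lam μ s m).real C := by
  have := isProbabilityMeasure_uniformOn_balanced hN
  have := isProbabilityMeasure_csbm hN d lam μ s m
  rw [measureReal_def, ← ENNReal.ofReal_le_iff_le_toReal (measure_ne_top _ _), csbm_apply _ _ _ _ _ _ hC]
  calc _ = ∫⁻ _, ENNReal.ofReal (∑ q ∈ Q, shapeBound N (dIn d lam / N) (dOut d lam / N) q * t q)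
        ∂(uniformOn {iv : Fin (2 * N) × (Fin (2 * N) → ℤˣ) | Balanced iv.2}) := by simp
    _ ≤ _ := by
        refine lintegral_mono_ae ?_
        filter_upwards [ae_cond_mem (Set.toFinite
          {iv : Fin (2 * N) × (Fin (2 * N) → ℤˣ) | Balanced iv.2}).measurableSet] with iv hiv
        exact sampleLaw_ge (Balanced.classSize hiv) (edgeProb_eq h1 h2 iv.2) hC ht
          (fun q G hG => h iv.1 iv.2 q G hG) Q

end Average

end CSBM

end

/-! ### Conclusion: the squeeze applied to the accuracy. -/

theorem theorem3 {f : ℕ} (d lam μ s K : ℝ) (m : CSBM.Feat f)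
    (hd : 0 ≤ d) (hlam : |lam| ≤ √d) (hs : 0 < s) (hK : K ≠ 0) (hm : ‖m‖ = 1) :
    ∃ L : ℝ,
      HasSum (fun q : ℕ × ℕ × ℕ × ℕ =>
        CSBM.countProb d lam q.1 q.2.1 q.2.2.1 q.2.2.2 *
          CSBM.Phi (CSBM.psi (Real.sign K * (μ / s)) q.1 q.2.1 q.2.2.1 q.2.2.2)) L ∧
      Tendsto (fun N : ℕ =>
        CSBM.accuracy (CSBM.csbm (2 * N) d lam μ s m) (CSBM.linearGCN K m)) atTop (𝓝 L) := by
  have hc := CSBM.hasSum_countProb hd hlam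
  set φ : ℕ × ℕ × ℕ × ℕ → ℝ := fun q =>
    CSBM.Phi (CSBM.psi (Real.sign K * (μ / s)) q.1 q.2.1 q.2.2.1 q.2.2.2) with hφ
  have hφ0 : ∀ q, 0 ≤ φ q := fun q => cdf_nonneg _ _
  have hφ1 : ∀ q, φ q ≤ 1 := fun q => cdf_le_one _ _
  have hsum : Summable fun q : ℕ × ℕ × ℕ × ℕ =>
      CSBM.countProb d lam q.1 q.2.1 q.2.2.1 q.2.2.2 * φ q :=
    Summable.of_nonneg_of_le
      (fun q => mul_nonneg (CSBM.countProb_nonneg hd hlam _ _ _ _) (hφ0 q))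
      (fun q => mul_le_of_le_one_right (CSBM.countProb_nonneg hd hlam _ _ _ _) (hφ1 q))
      hc.summable
  -- For large `N` the truncation in `edgeProb` is inactive.
  have hev : ∀ r : ℝ, 0 ≤ r → ∀ᶠ N : ℕ in atTop, r / N ∈ Set.Icc (0 : ℝ) 1 := by
    intro r hr
    filter_upwards [eventually_ge_atTop ⌈r⌉₊] with N hN
    exact ⟨by positivity, div_le_one_of_le₀ (Nat.ceil_le.1 hN) (by positivity)⟩
  have hIn := hev _ (CSBM.dIn_nonneg hd hlam)
  have hOut := hev _ (CSBM.dOut_nonneg hd hlam)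
  refine ⟨_, hsum.hasSum, CSBM.tendsto_of_sum_le hc hsum.hasSum
    (CSBM.tendsto_shapeBound d lam) (fun Q => ?_) fun Q => ?_⟩
  · filter_upwards [hIn, hOut, eventually_gt_atTop 0] with N h1 h2 hN
    exact CSBM.csbm_real_ge hN h1 h2 (CSBM.measurableSet_correct K m) hφ0
      (fun i v q G hG => (hG.noise_correct hs hK hm).ge) Q
  · filter_upwards [hIn, hOut, eventually_gt_atTop 0] with N h1 h2 hN
    have := CSBM.isProbabilityMeasure_csbm hN d lam μ s m
    rw [CSBM.accuracy, ← probReal_compl_eq_one_sub (CSBM.measurableSet_correct K m)]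
    -- The same bound for the complement, whose noise probability on shape `q` is `1 - φ q`.
    refine CSBM.csbm_real_ge hN h1 h2 (CSBM.measurableSet_correct K m).compl
      (fun q => sub_nonneg.2 (hφ1 q)) (fun i v q G hG => ?_) Q
    have hmeas : MeasurableSet {z : Fin (2 * N) → CSBM.Feat f |
        Real.sign (CSBM.linearGCN K m (G, i, v, CSBM.features μ m v z)) = ((v i : ℤ) : ℝ)} :=
      (CSBM.measurable_sample μ m (i, v)).comp measurable_prodMk_left
        (CSBM.measurableSet_correct K m)
    have hnoise := hG.noise_correct (μ := μ) hs hK hm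
    rw [hφ]
    simp only
    rw [← hnoise, ← probReal_compl_eq_one_sub hmeas]
    rfl
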